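/- Let $\Gamma$ be a finite set with at least two elements, let $0<r<1$ and $\lambda_i\in\mathbb R$ ($i\in\Gamma$), and let $f_i(x)=rx+\lambda_i$, a homogeneous affine iterated function system on $\mathbb R$. Write $f_{\mathtt i}=f_{i_1}\circ\cdots\circ f_{i_n}$ for $\mathtt i=(i_1,\dots,i_n)\in\Gamma^n$. Suppose that the system satisfies the weak separation condition: there is $c>0$ such that for all $n\ge 1$ and all $\mathtt i,\mathtt j\in\Gamma^n$, either $f_{\mathtt i}(0)=f_{\mathtt j}(0)$ or $|f_{\mathtt i}(0)-f_{\mathtt j}(0)|>c\,r^n$. Let $K$ be the attractor, i.e. the unique nonempty compact set with $K=\bigcup_{i\in\Gamma}f_i(K)$, and let $\pi:\Gamma^{\mathbb N}\to K$, $\pi(i_1,i_2,\dots)=\lim_{k\to\infty}f_{i_1}\circ\cdots\circ f_{i_k}(0)$, be the natural coding map. Let $\nu$ be a Borel probability measure on $\Gamma^{\mathbb N}$ that is invariant under the left shift, and let $\mu=\pi\nu=\nu\circ\pi^{-1}$. For a probability measure $\mu$ on $\mathbb R$, let $H_n(\mu)=-\sum_{Q}\mu(Q)\log_2\mu(Q)$,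 where $Q$ runs over the dyadic intervals $[k2^{-n},(k+1)2^{-n})$, $k\in\mathbb Z$, and let $\dim\mu=\liminf_{n\to\infty}H_n(\mu)/n$ be the (lower) entropy dimension of $\mu$. If $\dim\mu=\dim_{\rm H}K=s$, where $\dim_{\rm H}$ denotes Hausdorff dimension, then $\mu$ is absolutely continuous with respect to the $s$-dimensional Hausdorff measure $\mathcal H^s$ on $\mathbb R$. -/

import Mathlib

open MeasureTheory Filter Topology
open scoped ENNReal NNReal

noncomputable section

/-- A homogeneous affine iterated function system `x ↦ r * x + t i`, `i ∈ Γ`, on the real line,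
with a common contraction ratio `0 < r < 1`. -/
structure HomogeneousAffineIFS (Γ : Type*) where
  ratio : ℝ
  ratio_pos : 0 < ratio
  ratio_lt_one : ratio < 1
  translation : Γ → ℝ

namespace HomogeneousAffineIFS

/-- The contraction `f_i`. -/
def map {Γ : Type*} (F : HomogeneousAffineIFS Γ) (i : Γ) (x : ℝ) : ℝ :=
  F.ratio * x + F.translation i

/-- The composition `f_{i_1} ∘ ⋯ ∘ f_{i_n}` along a finite word. -/
def wordMap {Γ : Type*} (F : HomogeneousAffineIFS Γ) : List Γ → ℝ → ℝ
  | [] => id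
  | i :: w => F.map i ∘ F.wordMap w

/-- `K` is the attractor: the (unique) nonempty compact set with `K = ⋃ i, f_i(K)`. -/
def IsAttractor {Γ : Type*} (F : HomogeneousAffineIFS Γ) (K : Set ℝ) : Prop :=
  K.Nonempty ∧ IsCompact K ∧ K = ⋃ i, F.map i '' K

/-- The weak separation condition: there is `c > 0` such that, for all words `u`, `v` of the same
length `n ≥ 1`, the points `f_u(0)` and `f_v(0)` are equal or more than `c * r ^ n` apart. -/
def WeakSeparation {Γ : Type*} (F : HomogeneousAffineIFS Γ) : Prop :=
  ∃ c : ℝ, 0 < c ∧ ∀ n : ℕ, 1 ≤ n → ∀ u v : Fin n → Γ,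
    |F.wordMap (List.ofFn u) 0 - F.wordMap (List.ofFn v) 0| = 0 ∨
      c * F.ratio ^ n < |F.wordMap (List.ofFn u) 0 - F.wordMap (List.ofFn v) 0|

/-- The natural coding map `π(i) = lim_k f_{i_1} ⋯ f_{i_k}(0)`. -/
def coding {Γ : Type*} (F : HomogeneousAffineIFS Γ) (i : ℕ → Γ) : ℝ :=
  limUnder atTop fun k : ℕ => F.wordMap (List.ofFn fun j : Fin k => i j) 0

theorem wordMap_append {Γ : Type*} (F : HomogeneousAffineIFS Γ) (u : List Γ) (a : Γ) :
    F.wordMap (u ++ [a]) 0 = F.wordMap u 0 + F.translation a * F.ratio ^ u.length := by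
  induction u with
  | nil => simp [wordMap, map]
  | cons b u ih => simp [wordMap, map, ih]; ring

theorem wordMap_ofFn {Γ : Type*} (F : HomogeneousAffineIFS Γ) (i : ℕ → Γ) (k : ℕ) :
    F.wordMap (List.ofFn fun j : Fin k => i j) 0 =
      ∑ j ∈ Finset.range k, F.translation (i j) * F.ratio ^ j := by
  induction k with
  | zero => simp [wordMap]
  | succ k ih =>
    rw [List.ofFn_succ', List.concat_eq_append, wordMap_append, Finset.sum_range_succ, ← ih]
    simp

/-- The limit defining the coding map exists. -/
theorem tendsto_coding {Γ : Type*} [Finite Γ] (F : HomogeneousAffineIFS Γ) (i : ℕ → Γ) :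
    Tendsto (fun k : ℕ => F.wordMap (List.ofFn fun j : Fin k => i j) 0) atTop
      (𝓝 (F.coding i)) := by
  apply tendsto_nhds_limUnder
  obtain ⟨C, hC⟩ := (Set.finite_range fun a => |F.translation a|).bddAbove
  have hs : Summable fun j : ℕ => F.translation (i j) * F.ratio ^ j := by
    refine Summable.of_norm_bounded
      ((summable_geometric_of_lt_one F.ratio_pos.le F.ratio_lt_one).mul_left C) fun j => ?_
    rw [norm_mul, norm_pow, Real.norm_eq_abs, Real.norm_eq_abs, abs_of_pos F.ratio_pos]
    exact mul_le_mul_of_nonneg_right (hC ⟨i j, rfl⟩) (pow_nonneg F.ratio_pos.le j)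
  refine ⟨∑' j, F.translation (i j) * F.ratio ^ j, ?_⟩
  simp only [wordMap_ofFn]
  exact hs.hasSum.tendsto_sum_nat

/-- The coding map is measurable, so push-forwards along it are genuine. -/
theorem measurable_coding {Γ : Type*} [Finite Γ] [MeasurableSpace Γ] [DiscreteMeasurableSpace Γ]
    (F : HomogeneousAffineIFS Γ) : Measurable F.coding := by
  refine measurable_of_tendsto_metrizable (fun k => ?_)
    (tendsto_pi_nhds.2 fun i => F.tendsto_coding i)
  simp only [wordMap_ofFn]
  refine Finset.measurable_fun_sum _ fun j _ => Measurable.mul_const ?_ _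
  exact (Measurable.of_discrete (f := F.translation)).comp (measurable_pi_apply j)

end HomogeneousAffineIFS

/-- The left shift on `Γ^ℕ`. -/
def leftShift {Γ : Type*} (i : ℕ → Γ) : ℕ → Γ := fun n => i (n + 1)

/-- The half-open dyadic interval `[k 2⁻ⁿ, (k + 1) 2⁻ⁿ)`. -/
def dyadicInterval (n : ℕ) (k : ℤ) : Set ℝ :=
  Set.Ico ((k : ℝ) / 2 ^ n) (((k : ℝ) + 1) / 2 ^ n)

/-- The `n`-scale entropy of a probability measure on `ℝ`: its Shannon entropy, with logarithms to
base `2`, for the partition into dyadic intervals of length `2⁻ⁿ`. Each summand `-p log₂ p` is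
nonnegative, since `0 ≤ p ≤ 1`. -/
def scaleEntropy (μ : Measure ℝ) (n : ℕ) : ℝ≥0∞ :=
  ∑' k : ℤ, ENNReal.ofReal
    (-(μ.real (dyadicInterval n k) * Real.logb 2 (μ.real (dyadicInterval n k))))

/-- The (lower) entropy dimension of a probability measure on `ℝ`. -/
def entropyDim (μ : Measure ℝ) : ℝ≥0∞ :=
  liminf (fun n : ℕ => scaleEntropy μ n / (n : ℝ≥0∞)) atTop

end

/-! Let `N n` be the number of distinct points `f_u(0)` with `u` of length `n`, and `h n` the
Shannon entropy of this point when the word is drawn from `ν`. The proof plays a lower bound for `h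
n`, with no error term, against a counting bound for `N n` that is sharp up to a constant.

Counting: by weak separation, an interval of length comparable to `r ^ m` contains at most a
constant times `N (n - m)` points of level `n`, and `N m * N n ≤ M * N (m + n)`. For `t > dim K`, an
efficient cover of `K` makes `N n * r ^ (t * n)` bounded. Supermultiplicativity improves the bound
to `M`, whatever `t` is, and `t ↓ s` gives `N n ≤ M * r ^ (-s * n)`
(`exists_card_points_mul_pow_le`).

Entropy: shift invariance makes `h` subadditive, and `h n` controls the dyadic entropy of `μ` at
scale `r ^ n` up to a constant. Hence `dim μ ≥ s` forces `h n ≥ n * s * log (1 / r)` for every `n`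
(`le_pointEntropy_of_le_entropyDim`).

Contradiction: let `A` be compact and `H^s`-null with `μ A = p > 0`. A cover of `A` of tiny total
size shows that, at a suitable level, mass at least `p` sits on a tiny proportion of `r ^ (-s * n)`
points. This lowers `h n` below the entropy bound (`measure_preimage_coding_eq_zero`). -/

theorem leftShift_iterate {Γ : Type*} (m : ℕ) (i : ℕ → Γ) :
    leftShift^[m] i = fun k => i (m + k) := by
  induction m generalizing i with
  | zero => simp
  | succ m ih =>
    rw [Function.iterate_succ_apply, ih]
    funext k
    simp only [leftShift]
    congr 1
    omega

/-! ### Points of a given level and their counting under weak separation -/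

namespace HomogeneousAffineIFS

variable {Γ : Type*}

/-- The point `f_{i_1} ⋯ f_{i_n}(0)`, written as a partial sum of a power series in the ratio. -/
noncomputable def partialSum (F : HomogeneousAffineIFS Γ) (n : ℕ) (i : ℕ → Γ) : ℝ :=
  ∑ j ∈ Finset.range n, F.translation (i j) * F.ratio ^ j

theorem partialSum_add (F : HomogeneousAffineIFS Γ) (m n : ℕ) (i : ℕ → Γ) :
    F.partialSum (m + n) i =
      F.partialSum m i + F.ratio ^ m * F.partialSum n (leftShift^[m] i) := by
  simp only [partialSum, leftShift_iterate, Finset.sum_range_add, Finset.mul_sum]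
  congr 1
  refine Finset.sum_congr rfl fun j _ => ?_
  ring

theorem partialSum_eq_wordMap (F : HomogeneousAffineIFS Γ) (n : ℕ) (i : ℕ → Γ) :
    F.partialSum n i = F.wordMap (List.ofFn fun j : Fin n => i j) 0 :=
  (F.wordMap_ofFn i n).symm

theorem partialSum_congr (F : HomogeneousAffineIFS Γ) {n : ℕ} {i j : ℕ → Γ}
    (h : ∀ k < n, i k = j k) : F.partialSum n i = F.partialSum n j :=
  Finset.sum_congr rfl fun k hk => by rw [h k (Finset.mem_range.1 hk)]

theorem exists_partialSum_add (F : HomogeneousAffineIFS Γ) (m n : ℕ) (i j : ℕ → Γ) :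
    ∃ k, F.partialSum (m + n) k = F.partialSum m i + F.ratio ^ m * F.partialSum n j := by
  refine ⟨fun k => if k < m then i k else j (k - m), ?_⟩
  rw [partialSum_add, leftShift_iterate]
  congr 1
  · exact F.partialSum_congr fun k hk => by simp [hk]
  · congr 1
    exact F.partialSum_congr fun k _ => by simp

theorem finite_range_partialSum [Finite Γ] (F : HomogeneousAffineIFS Γ) (n : ℕ) :
    (Set.range (F.partialSum n)).Finite := by
  refine (Set.finite_range fun u : Fin n → Γ => F.wordMap (List.ofFn u) 0).subset ?_
  rintro _ ⟨i, rfl⟩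
  exact ⟨fun j => i j, (F.partialSum_eq_wordMap n i).symm⟩

/-- The set of points `f_u(0)`, for words `u` of length `n`. -/
noncomputable def points [Finite Γ] (F : HomogeneousAffineIFS Γ) (n : ℕ) : Finset ℝ :=
  (F.finite_range_partialSum n).toFinset

theorem mem_points [Finite Γ] {F : HomogeneousAffineIFS Γ} {n : ℕ} {x : ℝ} :
    x ∈ F.points n ↔ ∃ i, F.partialSum n i = x := by
  simp [points]

theorem partialSum_mem_points [Finite Γ] (F : HomogeneousAffineIFS Γ) (n : ℕ) (i : ℕ → Γ) :
    F.partialSum n i ∈ F.points n :=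
  mem_points.2 ⟨i, rfl⟩

theorem exists_partialSum_bound [Finite Γ] (F : HomogeneousAffineIFS Γ) :
    ∃ B : ℝ, 0 < B ∧ ∀ n i, |F.partialSum n i| ≤ B := by
  obtain ⟨C, hC⟩ := (Set.finite_range fun a => |F.translation a|).bddAbove
  have hr := sub_pos.2 F.ratio_lt_one
  refine ⟨(|C| + 1) * (1 - F.ratio)⁻¹, by positivity, fun n i => ?_⟩
  calc |F.partialSum n i| ≤ ∑ j ∈ Finset.range n, |F.translation (i j) * F.ratio ^ j| :=
        Finset.abs_sum_le_sum_abs _ _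
    _ ≤ ∑ j ∈ Finset.range n, (|C| + 1) * F.ratio ^ j := by
        refine Finset.sum_le_sum fun j _ => ?_
        rw [abs_mul, abs_of_pos (pow_pos F.ratio_pos j)]
        refine mul_le_mul_of_nonneg_right ?_ (pow_nonneg F.ratio_pos.le j)
        have : |F.translation (i j)| ≤ C := hC ⟨i j, rfl⟩
        linarith [le_abs_self C]
    _ ≤ (|C| + 1) * (1 - F.ratio)⁻¹ := by
        rw [← Finset.mul_sum, ← tsum_geometric_of_lt_one F.ratio_pos.le F.ratio_lt_one]
        gcongr
        exact (summable_geometric_of_lt_one F.ratio_pos.le F.ratio_lt_one).sum_le_tsum _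
          fun j _ => pow_nonneg F.ratio_pos.le j

theorem tendsto_partialSum [Finite Γ] (F : HomogeneousAffineIFS Γ) (i : ℕ → Γ) :
    Tendsto (fun n => F.partialSum n i) atTop (𝓝 (F.coding i)) := by
  simpa only [partialSum_eq_wordMap] using F.tendsto_coding i

theorem abs_coding_sub_partialSum_le [Finite Γ] (F : HomogeneousAffineIFS Γ) {B : ℝ}
    (hB : ∀ n i, |F.partialSum n i| ≤ B) (n : ℕ) (i : ℕ → Γ) :
    |F.coding i - F.partialSum n i| ≤ B * F.ratio ^ n := by
  have h : Tendsto (fun k => |F.partialSum (n + k) i - F.partialSum n i|) atTop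
      (𝓝 |F.coding i - F.partialSum n i|) :=
    (((F.tendsto_partialSum i).comp
      (tendsto_atTop_mono (fun k => Nat.le_add_left k n) tendsto_id)).sub_const _).abs
  refine le_of_tendsto' h fun k => ?_
  rw [partialSum_add, add_sub_cancel_left, abs_mul, abs_of_pos (pow_pos F.ratio_pos n), mul_comm]
  exact mul_le_mul_of_nonneg_right (hB _ _) (pow_nonneg F.ratio_pos.le n)

theorem wordMap_apply (F : HomogeneousAffineIFS Γ) (w : List Γ) (x : ℝ) :
    F.wordMap w x = F.wordMap w 0 + F.ratio ^ w.length * x := by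
  induction w with
  | nil => simp [wordMap]
  | cons a w ih => simp only [wordMap, Function.comp_apply, map, ih, List.length_cons]; ring

theorem IsAttractor.wordMap_mem {F : HomogeneousAffineIFS Γ} {K : Set ℝ} (hK : F.IsAttractor K)
    {x : ℝ} (hx : x ∈ K) (w : List Γ) : F.wordMap w x ∈ K := by
  induction w with
  | nil => exact hx
  | cons a w ih =>
    rw [hK.2.2]
    exact Set.mem_iUnion.2 ⟨a, _, ih, rfl⟩

theorem IsAttractor.coding_mem [Finite Γ] {F : HomogeneousAffineIFS Γ} {K : Set ℝ}
    (hK : F.IsAttractor K) (i : ℕ → Γ) : F.coding i ∈ K := by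
  obtain ⟨x, hx⟩ := hK.1
  have h : Tendsto (fun n => F.partialSum n i + F.ratio ^ n * x) atTop
      (𝓝 (F.coding i + 0 * x)) :=
    (F.tendsto_partialSum i).add
      ((tendsto_pow_atTop_nhds_zero_of_lt_one F.ratio_pos.le F.ratio_lt_one).mul_const x)
  rw [zero_mul, add_zero] at h
  refine hK.2.1.isClosed.mem_of_tendsto h (Eventually.of_forall fun n => ?_)
  have := hK.wordMap_mem hx (List.ofFn fun j : Fin n => i j)
  rwa [wordMap_apply, ← partialSum_eq_wordMap, List.length_ofFn] at this

theorem WeakSeparation.exists_separation [Finite Γ] {F : HomogeneousAffineIFS Γ}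
    (hF : F.WeakSeparation) :
    ∃ c : ℝ, 0 < c ∧ ∀ n, ∀ x ∈ F.points n, ∀ y ∈ F.points n, x ≠ y →
      c * F.ratio ^ n < |x - y| := by
  obtain ⟨c, hc, h⟩ := hF
  refine ⟨c, hc, fun n x hx y hy hxy => ?_⟩
  obtain ⟨i, rfl⟩ := mem_points.1 hx
  obtain ⟨j, rfl⟩ := mem_points.1 hy
  rcases n.eq_zero_or_pos with rfl | hn
  · simp [partialSum] at hxy
  · rw [partialSum_eq_wordMap, partialSum_eq_wordMap] at hxy ⊢
    exact (h n hn _ _).resolve_left (abs_ne_zero.2 (sub_ne_zero.2 hxy))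

/-- Rescaled by `c * r ^ n`, distinct points have distinct integer parts. The extra `1` only keeps
`M` positive. -/
theorem WeakSeparation.exists_card_points_near_le [Finite Γ] {F : HomogeneousAffineIFS Γ}
    (hF : F.WeakSeparation) (a : ℝ) :
    ∃ M : ℕ, 0 < M ∧ ∀ n x, {z ∈ F.points n | |z - x| ≤ a * F.ratio ^ n}.card ≤ M := by
  obtain ⟨c, hc, hsep⟩ := hF.exists_separation
  refine ⟨(Finset.Icc ⌊-a / c⌋ ⌊a / c⌋).card + 1, Nat.succ_pos _, fun n x => ?_⟩
  have hr : 0 < F.ratio ^ n := pow_pos F.ratio_pos n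
  have hcr : 0 < c * F.ratio ^ n := mul_pos hc hr
  refine (Finset.card_le_card_of_injOn (fun z => ⌊(z - x) / (c * F.ratio ^ n)⌋) ?_ ?_).trans
    (Nat.le_succ _)
  · intro z hz
    obtain ⟨h1, h2⟩ := abs_le.1 (Finset.mem_filter.1 hz).2
    refine Finset.mem_coe.2 (Finset.mem_Icc.2 ⟨Int.floor_le_floor ?_, Int.floor_le_floor ?_⟩)
    · rw [div_le_div_iff₀ hc hcr]
      nlinarith
    · rw [div_le_div_iff₀ hcr hc]
      nlinarith
  · intro y hy z hz hyz
    by_contra hne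
    have h1 := hsep n y (Finset.mem_filter.1 hy).1 z (Finset.mem_filter.1 hz).1 hne
    have h2 := Int.abs_sub_lt_one_of_floor_eq_floor hyz
    rw [← sub_div, sub_sub_sub_cancel_right, abs_div, abs_of_pos hcr, div_lt_one hcr] at h2
    exact lt_asymm h1 h2

theorem add_mem_points [Finite Γ] {F : HomogeneousAffineIFS Γ} {m n : ℕ} {x y : ℝ}
    (hx : x ∈ F.points m) (hy : y ∈ F.points n) : x + F.ratio ^ m * y ∈ F.points (m + n) := by
  obtain ⟨i, rfl⟩ := mem_points.1 hx
  obtain ⟨j, rfl⟩ := mem_points.1 hy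
  exact mem_points.2 (F.exists_partialSum_add m n i j)

/-- The number of points of a given level is supermultiplicative up to a constant. -/
theorem WeakSeparation.exists_card_points_mul_le [Finite Γ] {F : HomogeneousAffineIFS Γ}
    (hF : F.WeakSeparation) :
    ∃ M : ℕ, 0 < M ∧ ∀ m n,
      (F.points m).card * (F.points n).card ≤ M * (F.points (m + n)).card := by
  obtain ⟨B, hB0, hB⟩ := F.exists_partialSum_bound
  obtain ⟨M, hM0, hM⟩ := hF.exists_card_points_near_le B
  refine ⟨M, hM0, fun m n => ?_⟩
  rw [← Finset.card_product]
  -- In a fibre of `(x, y) ↦ x + r ^ m * y` over `z`, the coordinate `x` determines `y` and lies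
  -- within `B * r ^ m` of `z`.
  refine Finset.card_le_mul_card_image_of_maps_to
    (f := fun p : ℝ × ℝ => p.1 + F.ratio ^ m * p.2) ?_ M ?_
  · intro p hp
    exact add_mem_points (Finset.mem_product.1 hp).1 (Finset.mem_product.1 hp).2
  · intro z _
    refine (Finset.card_le_card_of_injOn Prod.fst ?_ ?_).trans (hM m z)
    · intro p hp
      obtain ⟨hp', rfl⟩ := Finset.mem_filter.1 hp
      obtain ⟨h1, h2⟩ := Finset.mem_product.1 hp'
      obtain ⟨j, hj⟩ := mem_points.1 h2
      refine Finset.mem_coe.2 (Finset.mem_filter.2 ⟨h1, ?_⟩)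
      rw [sub_add_cancel_left, abs_neg, abs_mul, abs_of_pos (pow_pos F.ratio_pos m), ← hj,
        mul_comm]
      exact mul_le_mul_of_nonneg_right (hB _ _) (pow_nonneg F.ratio_pos.le m)
    · intro p hp q hq hpq
      have h1 := (Finset.mem_filter.1 hp).2
      rw [← (Finset.mem_filter.1 hq).2, hpq] at h1
      exact Prod.ext hpq (mul_left_cancel₀ (pow_pos F.ratio_pos m).ne' (add_left_cancel h1))

/-- The points of level `n` that lie in an interval of length comparable to `r ^ m`. -/
theorem WeakSeparation.exists_card_points_near_le_mul [Finite Γ] {F : HomogeneousAffineIFS Γ}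
    (hF : F.WeakSeparation) (a : ℝ) :
    ∃ M : ℕ, 0 < M ∧ ∀ m n x, m ≤ n →
      {z ∈ F.points n | |z - x| ≤ a * F.ratio ^ m}.card ≤ M * (F.points (n - m)).card := by
  obtain ⟨B, hB0, hB⟩ := F.exists_partialSum_bound
  obtain ⟨M, hM0, hM⟩ := hF.exists_card_points_near_le (a + B)
  refine ⟨M, hM0, fun m n x hmn => ?_⟩
  obtain ⟨k, rfl⟩ := Nat.exists_eq_add_of_le hmn
  rw [Nat.add_sub_cancel_left]
  refine le_trans ?_ (Nat.mul_le_mul_right _ (hM m x))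
  rw [← Finset.card_product]
  refine le_trans (Finset.card_le_card ?_)
    (Finset.card_image_le (f := fun p : ℝ × ℝ => p.1 + F.ratio ^ m * p.2))
  intro z hz
  obtain ⟨hz, hzx⟩ := Finset.mem_filter.1 hz
  obtain ⟨i, rfl⟩ := mem_points.1 hz
  rw [partialSum_add] at hzx ⊢
  refine Finset.mem_image.2 ⟨(F.partialSum m i, F.partialSum k (leftShift^[m] i)),
    Finset.mem_product.2 ⟨Finset.mem_filter.2 ⟨F.partialSum_mem_points m i, ?_⟩,
      F.partialSum_mem_points k _⟩, rfl⟩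
  have h1 := mul_le_mul_of_nonneg_left (hB k (leftShift^[m] i)) (pow_nonneg F.ratio_pos.le m)
  rw [← abs_of_pos (pow_pos F.ratio_pos m), ← abs_mul, abs_of_pos (pow_pos F.ratio_pos m)] at h1
  rw [abs_le] at *
  constructor <;> linarith

open Classical in
/-- The points of level `n` that code a point of `A`. -/
noncomputable def pointsMeeting [Finite Γ] (F : HomogeneousAffineIFS Γ) (n : ℕ) (A : Set ℝ) :
    Finset ℝ :=
  {z ∈ F.points n | ∃ i, F.partialSum n i = z ∧ F.coding i ∈ A}

/-- If `π(i)` lies in the `j`-th ball, the level-`n` point of `i` is within `(2 + B) * r ^ m j` of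
its centre, because `m j ≤ n`. -/
theorem WeakSeparation.exists_card_pointsMeeting_le [Finite Γ] {F : HomogeneousAffineIFS Γ}
    (hF : F.WeakSeparation) :
    ∃ M : ℕ, 0 < M ∧ ∀ (A : Set ℝ) (J : Finset ℕ) (x : ℕ → ℝ) (m : ℕ → ℕ) (n : ℕ),
      A ⊆ ⋃ j ∈ J, Metric.ball (x j) (2 * F.ratio ^ m j) → (∀ j ∈ J, m j ≤ n) →
      (F.pointsMeeting n A).card ≤ M * ∑ j ∈ J, (F.points (n - m j)).card := by
  classical
  obtain ⟨B, hB0, hB⟩ := F.exists_partialSum_bound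
  obtain ⟨M, hM0, hM⟩ := hF.exists_card_points_near_le_mul (2 + B)
  refine ⟨M, hM0, fun A J x m n hA hmn => ?_⟩
  rw [Finset.mul_sum]
  refine le_trans (Finset.card_le_card ?_) (Finset.card_biUnion_le.trans
    (Finset.sum_le_sum fun j hj => hM (m j) n (x j) (hmn j hj)))
  intro z hz
  obtain ⟨hz, i, rfl, hi⟩ := Finset.mem_filter.1 hz
  obtain ⟨j, hj, hij⟩ := Set.mem_iUnion₂.1 (hA hi)
  refine Finset.mem_biUnion.2 ⟨j, hj, Finset.mem_filter.2 ⟨hz, ?_⟩⟩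
  have h1 := F.abs_coding_sub_partialSum_le hB n i
  have h2 : B * F.ratio ^ n ≤ B * F.ratio ^ m j :=
    mul_le_mul_of_nonneg_left
      (pow_le_pow_of_le_one F.ratio_pos.le F.ratio_lt_one.le (hmn j hj)) hB0.le
  rw [Metric.mem_ball, Real.dist_eq] at hij
  rw [abs_le] at *
  rw [abs_lt] at hij
  constructor <;> linarith [h1.1, h1.2, hij.1, hij.2]

end HomogeneousAffineIFS

/-! ### Covers by balls whose radii are powers of the ratio -/

/-- Rounding `d` up to a power of `r` costs at most a factor `r⁻¹`. The slack `η` is needed for `d =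
0`, where no largest exponent exists. -/
theorem exists_le_pow_and_pow_le {r t d η : ℝ} (hr0 : 0 < r) (hr1 : r < 1) (ht : 0 < t)
    (hd0 : 0 ≤ d) (hd1 : d ^ t < 1) (hη : 0 < η) :
    ∃ m : ℕ, d ≤ r ^ m ∧ (r ^ t) ^ m ≤ (r ^ t)⁻¹ * d ^ t + η := by
  have hρ : 0 < r ^ t := Real.rpow_pos_of_pos hr0 t
  rcases hd0.eq_or_lt with rfl | hd
  · obtain ⟨m, hm⟩ := exists_pow_lt_of_lt_one hη (Real.rpow_lt_one hr0.le hr1 ht)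
    refine ⟨m, (pow_pos hr0 m).le, ?_⟩
    rw [Real.zero_rpow ht.ne', mul_zero, zero_add]
    exact hm.le
  · have hd1' : d ≤ 1 := by
      by_contra! h
      exact hd1.not_ge (Real.one_le_rpow h.le ht.le)
    obtain ⟨m, h1, h2⟩ := exists_nat_pow_near_of_lt_one hd hd1' hr0 hr1
    refine ⟨m, h2, ?_⟩
    have h3 : (r ^ t) ^ (m + 1) ≤ d ^ t := by
      rw [Real.rpow_pow_comm hr0.le]
      exact Real.rpow_le_rpow (pow_nonneg hr0.le _) h1.le ht.le
    have h4 : (r ^ t) ^ m ≤ (r ^ t)⁻¹ * d ^ t := by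
      rw [inv_mul_eq_div, le_div_iff₀ hρ, ← pow_succ]
      exact h3
    linarith

/-- A compact set of zero Hausdorff measure has finite covers by balls of radius `2 * r ^ m`, with
arbitrarily small total `t`-dimensional size. -/
theorem IsCompact.exists_finite_cover_of_hausdorffMeasure_eq_zero {r t ε : ℝ} {A : Set ℝ}
    (hA : IsCompact A) (h0 : μH[t] A = 0) (hr0 : 0 < r) (hr1 : r < 1) (ht : 0 < t) (hε : 0 < ε) :
    ∃ (J : Finset ℕ) (x : ℕ → ℝ) (m : ℕ → ℕ),
      A ⊆ ⋃ j ∈ J, Metric.ball (x j) (2 * r ^ m j) ∧ ∑ j ∈ J, (r ^ t) ^ m j ≤ ε := by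
  have hρ : 0 < r ^ t := Real.rpow_pos_of_pos hr0 t
  -- The first entry absorbs the rounding factor `r ^ (-t)`; the second keeps every diameter below
  -- `1`.
  set δ : ℝ := min (ε / 2 * r ^ t) (1 / 2) with hδ
  have hδ0 : 0 < δ := by positivity
  obtain ⟨V, hAV, hV1, hV⟩ : ∃ V : ℕ → Set ℝ, A ⊆ ⋃ n, V n ∧ (∀ n, Metric.ediam (V n) ≤ 1) ∧
      ∑' n, Metric.ediam (V n) ^ t < ENNReal.ofReal δ := by
    rw [Measure.hausdorffMeasure_apply, ENNReal.iSup_eq_zero] at h0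
    have h1 := ENNReal.iSup_eq_zero.1 (h0 1) one_pos
    have h2 : _ < ENNReal.ofReal δ := h1.trans_lt (ENNReal.ofReal_pos.2 hδ0)
    simp only [iInf_lt_iff] at h2
    obtain ⟨V, hAV, hV1, hV⟩ := h2
    refine ⟨V, hAV, hV1, lt_of_le_of_lt (ENNReal.tsum_le_tsum fun n => ?_) hV⟩
    rcases (V n).eq_empty_or_nonempty with h | h
    · simp [h, ht]
    · simp [h]
  have hfin : ∀ n, Metric.ediam (V n) ≠ ∞ := fun n => ((hV1 n).trans_lt ENNReal.one_lt_top).ne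
  set d : ℕ → ℝ := fun n => (Metric.ediam (V n)).toReal with hd
  have hsum : ∀ J : Finset ℕ, ∑ j ∈ J, d j ^ t ≤ δ := by
    intro J
    rw [← ENNReal.ofReal_le_ofReal_iff hδ0.le, ENNReal.ofReal_sum_of_nonneg
      fun j _ => Real.rpow_nonneg ENNReal.toReal_nonneg t]
    refine le_trans (le_of_eq (Finset.sum_congr rfl fun j _ => ?_))
      ((ENNReal.sum_le_tsum J).trans hV.le)
    rw [← ENNReal.ofReal_rpow_of_nonneg ENNReal.toReal_nonneg ht.le, ENNReal.ofReal_toReal (hfin j)]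
  have hd1 : ∀ n, d n ^ t < 1 := fun n => by
    have := hsum {n}
    rw [Finset.sum_singleton] at this
    linarith [min_le_right (ε / 2 * r ^ t) (1 / 2)]
  -- The slacks form a geometric series with sum `ε / 2`.
  choose m hm1 hm2 using fun n => exists_le_pow_and_pow_le hr0 hr1 ht
    (ENNReal.toReal_nonneg : 0 ≤ d n) (hd1 n) (show 0 < ε / 2 / 2 / 2 ^ n by positivity)
  have hx : ∀ n, ∃ x, V n ⊆ Metric.ball x (2 * r ^ m n) := by
    intro n
    rcases (V n).eq_empty_or_nonempty with h | ⟨x, hx⟩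
    · exact ⟨0, by simp [h]⟩
    · refine ⟨x, fun y hy => ?_⟩
      rw [Metric.mem_ball, dist_edist]
      have h1 : (edist y x).toReal ≤ d n :=
        ENNReal.toReal_mono (hfin n) (Metric.edist_le_ediam_of_mem hy hx)
      linarith [hm1 n, pow_pos hr0 (m n)]
  choose x hx using hx
  obtain ⟨J, hJ⟩ := hA.elim_finite_subcover (fun n => Metric.ball (x n) (2 * r ^ m n))
    (fun n => Metric.isOpen_ball) (hAV.trans (Set.iUnion_mono hx))
  refine ⟨J, x, m, hJ, (Finset.sum_le_sum fun j _ => hm2 j).trans ?_⟩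
  rw [Finset.sum_add_distrib, ← Finset.mul_sum]
  have h1 : (r ^ t)⁻¹ * ∑ j ∈ J, d j ^ t ≤ ε / 2 := by
    rw [inv_mul_eq_div, div_le_iff₀ hρ]
    exact (hsum J).trans (min_le_left _ _)
  have h2 : ∑ j ∈ J, ε / 2 / 2 / 2 ^ j ≤ ε / 2 :=
    sum_le_hasSum J (fun j _ => by positivity) (hasSum_geometric_two' (ε / 2))
  linarith

/-! ### Growth of the number of points -/

namespace HomogeneousAffineIFS

variable {Γ : Type*} [Finite Γ]

theorem pointsMeeting_eq_points {F : HomogeneousAffineIFS Γ} {A : Set ℝ}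
    (hA : ∀ i, F.coding i ∈ A) (n : ℕ) : F.pointsMeeting n A = F.points n := by
  classical
  refine Finset.filter_true_of_mem fun z hz => ?_
  obtain ⟨i, hi⟩ := mem_points.1 hz
  exact ⟨i, hi, hA i⟩

/-- A cover of `K` bounds the count at level `n` by counts at strictly lower levels, and a small
total size makes this recursion contract. -/
theorem WeakSeparation.exists_card_points_mul_pow_le_of_hausdorffMeasure_eq_zero
    {F : HomogeneousAffineIFS Γ} (hF : F.WeakSeparation) {K : Set ℝ} (hK : F.IsAttractor K)
    {t : ℝ} (ht : 0 < t) (h0 : μH[t] K = 0) :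
    ∃ B : ℝ, ∀ n, ((F.points n).card : ℝ) * (F.ratio ^ t) ^ n ≤ B := by
  obtain ⟨M, hM0, hM⟩ := hF.exists_card_pointsMeeting_le
  have hρ : 0 < F.ratio ^ t := Real.rpow_pos_of_pos F.ratio_pos t
  have hM0' : (0 : ℝ) < M := Nat.cast_pos.2 hM0
  have hM1 : (1 : ℝ) ≤ M := Nat.one_le_cast.2 hM0
  obtain ⟨J, x, m, hJ, hsum⟩ := hK.2.1.exists_finite_cover_of_hausdorffMeasure_eq_zero h0
    F.ratio_pos F.ratio_lt_one ht (ε := 1 / (2 * M)) (by positivity)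
  -- A ball with `m j = 0` alone would contribute `1 > 1 / (2 * M)`.
  have hm : ∀ j ∈ J, 0 < m j := by
    intro j hj
    by_contra! h
    have h1 := (Finset.single_le_sum (f := fun j => (F.ratio ^ t) ^ m j)
      (fun j _ => (pow_pos hρ _).le) hj).trans hsum
    simp only [Nat.le_zero.1 h, pow_zero] at h1
    rw [le_div_iff₀ (by positivity)] at h1
    linarith
  set a : ℕ → ℝ := fun n => ((F.points n).card : ℝ) * (F.ratio ^ t) ^ n with ha
  have ha0 : ∀ n, 0 ≤ a n := fun n => by positivity
  refine ⟨∑ k ∈ Finset.range (J.sup m + 1), a k, fun n => ?_⟩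
  set B := ∑ k ∈ Finset.range (J.sup m + 1), a k
  have hB : 0 ≤ B := Finset.sum_nonneg fun k _ => ha0 k
  change a n ≤ B
  induction n using Nat.strong_induction_on with
  | _ n ih =>
  rcases lt_or_ge n (J.sup m + 1) with hn | hn
  · exact Finset.single_le_sum (f := a) (fun k _ => ha0 k) (Finset.mem_range.2 hn)
  · have hmn : ∀ j ∈ J, m j ≤ n := fun j hj => (Finset.le_sup hj).trans (by omega)
    have h1 := hM K J x m n hJ hmn
    rw [pointsMeeting_eq_points hK.coding_mem] at h1
    have h2 : ((F.points n).card : ℝ) ≤ M * ∑ j ∈ J, ((F.points (n - m j)).card : ℝ) := by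
      exact_mod_cast h1
    calc a n ≤ (M * ∑ j ∈ J, ((F.points (n - m j)).card : ℝ)) * (F.ratio ^ t) ^ n :=
          mul_le_mul_of_nonneg_right h2 (pow_pos hρ n).le
      _ = M * ∑ j ∈ J, a (n - m j) * (F.ratio ^ t) ^ m j := by
          rw [mul_assoc, Finset.sum_mul]
          congr 1
          refine Finset.sum_congr rfl fun j hj => ?_
          rw [ha, mul_assoc, ← pow_add, Nat.sub_add_cancel (hmn j hj)]
      _ ≤ M * ∑ j ∈ J, B * (F.ratio ^ t) ^ m j := by
          gcongr with j hj
          exact ih _ (Nat.sub_lt ((hm j hj).trans_le (hmn j hj)) (hm j hj))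
      _ = B * (M * ∑ j ∈ J, (F.ratio ^ t) ^ m j) := by rw [← Finset.mul_sum]; ring
      _ ≤ B * (M * (1 / (2 * M))) :=
          mul_le_mul_of_nonneg_left (mul_le_mul_of_nonneg_left hsum hM0'.le) hB
      _ ≤ B := by
          have h3 : (M : ℝ) * (1 / (2 * M)) = 1 / 2 := by field_simp
          rw [h3]
          linarith [hB]

theorem card_points_zero [Nonempty Γ] (F : HomogeneousAffineIFS Γ) : (F.points 0).card = 1 :=
  Finset.card_eq_one.2 ⟨0, Finset.ext fun x => by
    rw [mem_points, Finset.mem_singleton]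
    simp only [partialSum, Finset.range_zero, Finset.sum_empty, exists_const, eq_comm]⟩

/-- The number of points of level `n` is at most a constant times `r ^ (-n * dim K)`. -/
theorem WeakSeparation.exists_card_points_mul_pow_le [Nonempty Γ]
    {F : HomogeneousAffineIFS Γ} (hF : F.WeakSeparation) {K : Set ℝ} (hK : F.IsAttractor K)
    {s : ℝ≥0} (hs : dimH K ≤ s) :
    ∃ M : ℝ, 0 < M ∧ ∀ n, ((F.points n).card : ℝ) * (F.ratio ^ (s : ℝ)) ^ n ≤ M := by
  obtain ⟨M, hM0, hM⟩ := hF.exists_card_points_mul_le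
  have hM0' : (0 : ℝ) < M := Nat.cast_pos.2 hM0
  have hpow : ∀ n k, ((F.points n).card : ℝ) ^ k ≤ (M : ℝ) ^ k * (F.points (k * n)).card := by
    intro n k
    induction k with
    | zero => rw [pow_zero, pow_zero, zero_mul, card_points_zero, Nat.cast_one, mul_one]
    | succ k ih =>
      have h1 : ((F.points (k * n)).card : ℝ) * (F.points n).card ≤
          M * (F.points (k * n + n)).card := by exact_mod_cast hM (k * n) n
      rw [Nat.succ_mul]
      calc ((F.points n).card : ℝ) ^ (k + 1)
          ≤ ((M : ℝ) ^ k * (F.points (k * n)).card) * (F.points n).card := by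
            rw [pow_succ]; gcongr
        _ ≤ (M : ℝ) ^ k * (M * (F.points (k * n + n)).card) := by
            rw [mul_assoc]; gcongr
        _ = _ := by ring
  -- The bound `B` depends on `t`, but a value above `M` at level `n` would grow geometrically along
  -- the levels `k * n`, by `hpow`. So `M` works for all `t > s`.
  have key : ∀ t : ℝ≥0, s < t → ∀ n, ((F.points n).card : ℝ) * (F.ratio ^ (t : ℝ)) ^ n ≤ M := by
    intro t hst n
    have hρ : 0 < F.ratio ^ (t : ℝ) := Real.rpow_pos_of_pos F.ratio_pos _
    obtain ⟨B, hB⟩ := hF.exists_card_points_mul_pow_le_of_hausdorffMeasure_eq_zero hK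
      (NNReal.coe_pos.2 (pos_of_gt hst))
      (hausdorffMeasure_of_dimH_lt (hs.trans_lt (ENNReal.coe_lt_coe.2 hst)))
    by_contra! h
    obtain ⟨k, hk⟩ := pow_unbounded_of_one_lt B ((one_lt_div hM0').2 h)
    refine hk.not_ge (le_trans ?_ (hB (k * n)))
    rw [div_pow, div_le_iff₀ (pow_pos hM0' k), mul_pow, ← pow_mul, mul_comm n k]
    calc _ ≤ ((M : ℝ) ^ k * (F.points (k * n)).card) * (F.ratio ^ (t : ℝ)) ^ (k * n) :=
          mul_le_mul_of_nonneg_right (hpow n k) (pow_pos hρ _).le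
      _ = _ := by ring
  refine ⟨M, hM0', fun n => ?_⟩
  have hc : Continuous fun t : ℝ≥0 => ((F.points n).card : ℝ) * (F.ratio ^ (t : ℝ)) ^ n :=
    continuous_const.mul
      ((continuous_const.rpow NNReal.continuous_coe fun _ => Or.inl F.ratio_pos.ne').pow n)
  refine le_of_tendsto ((hc.tendsto s).mono_left (nhdsWithin_le_nhds (s := Set.Ioi s))) ?_
  filter_upwards [self_mem_nhdsWithin] with t ht using key t ht n

end HomogeneousAffineIFS

/-! ### Entropy inequalities for finite sums -/

namespace Real

/-- Gibbs' inequality term by term, from `log x ≤ x - 1` at `x = q / w`. Uniform and product choices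
of `q` give the next entropy bounds. -/
theorem negMulLog_le_cross {w q : ℝ} (hw : 0 ≤ w) (hq : 0 ≤ q) (h : q = 0 → w = 0) :
    negMulLog w ≤ -w * log q + q - w := by
  rcases hw.eq_or_lt with rfl | hw
  · simpa using hq
  · have hq : 0 < q := hq.lt_of_ne fun h0 => hw.ne' (h h0.symm)
    have h1 := mul_le_mul_of_nonneg_left (log_le_sub_one_of_pos (div_pos hq hw)) hw.le
    rw [log_div hq.ne' hw.ne', mul_sub, mul_sub, mul_div_cancel₀ _ hw.ne'] at h1
    rw [negMulLog]
    linarith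

theorem log_natCast_le_log_natCast {m n : ℕ} (h : m ≤ n) : log m ≤ log n := by
  rcases m.eq_zero_or_pos with rfl | hm
  · rw [Nat.cast_zero, log_zero]
    exact log_natCast_nonneg n
  · exact log_le_log (Nat.cast_pos.2 hm) (Nat.cast_le.2 h)

variable {ι κ : Type*}

theorem sum_negMulLog_le_add_log_card (T : Finset ι) {w : ι → ℝ} (hw : ∀ i ∈ T, 0 ≤ w i) :
    ∑ i ∈ T, negMulLog (w i) ≤
      negMulLog (∑ i ∈ T, w i) + (∑ i ∈ T, w i) * log T.card := by
  set W := ∑ i ∈ T, w i with hW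
  rcases T.eq_empty_or_nonempty with rfl | hT
  · simp [hW]
  have hW0 : 0 ≤ W := Finset.sum_nonneg hw
  have hT0 : (0 : ℝ) < T.card := Nat.cast_pos.2 hT.card_pos
  rcases hW0.eq_or_lt with h0 | hWpos
  · rw [← h0, negMulLog_zero, zero_mul, add_zero]
    refine (Finset.sum_eq_zero fun i hi => ?_).le
    rw [(Finset.sum_eq_zero_iff_of_nonneg hw).1 (hW.symm.trans h0.symm) i hi, negMulLog_zero]
  · have hq : 0 < W / T.card := div_pos hWpos hT0
    calc ∑ i ∈ T, negMulLog (w i)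
        ≤ ∑ i ∈ T, (-w i * log (W / T.card) + W / T.card - w i) :=
          Finset.sum_le_sum fun i hi =>
            negMulLog_le_cross (hw i hi) hq.le fun h => absurd h hq.ne'
      _ = negMulLog W + W * log T.card := by
          rw [Finset.sum_sub_distrib, Finset.sum_add_distrib, ← Finset.sum_mul,
            Finset.sum_neg_distrib, ← hW, Finset.sum_const, nsmul_eq_mul,
            mul_div_cancel₀ _ hT0.ne', log_div hWpos.ne' hT0.ne', negMulLog]
          ring

theorem negMulLog_sum_le (T : Finset ι) {w : ι → ℝ} (hw : ∀ i ∈ T, 0 ≤ w i) :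
    negMulLog (∑ i ∈ T, w i) ≤ ∑ i ∈ T, negMulLog (w i) := by
  rw [negMulLog, ← Finset.sum_neg_distrib, Finset.sum_mul]
  refine Finset.sum_le_sum fun i hi => ?_
  rw [negMulLog, neg_mul, neg_mul, neg_le_neg_iff]
  rcases (hw i hi).eq_or_lt with h | h
  · simp [← h]
  · exact mul_le_mul_of_nonneg_left (log_le_log h (Finset.single_le_sum hw hi)) h.le

theorem sum_product_negMulLog_le (S : Finset ι) (T : Finset κ) {w : ι → κ → ℝ}
    (hw : ∀ i j, 0 ≤ w i j) (h1 : ∑ i ∈ S, ∑ j ∈ T, w i j = 1) :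
    ∑ i ∈ S, ∑ j ∈ T, negMulLog (w i j) ≤
      ∑ i ∈ S, negMulLog (∑ j ∈ T, w i j) + ∑ j ∈ T, negMulLog (∑ i ∈ S, w i j) := by
  set a : ι → ℝ := fun i => ∑ j ∈ T, w i j with ha
  set b : κ → ℝ := fun j => ∑ i ∈ S, w i j with hb
  have ha0 : ∀ i, 0 ≤ a i := fun i => Finset.sum_nonneg fun j _ => hw i j
  have hb0 : ∀ j, 0 ≤ b j := fun j => Finset.sum_nonneg fun i _ => hw i j
  have ha1 : ∑ i ∈ S, a i = 1 := h1
  have hb1 : ∑ j ∈ T, b j = 1 := by rw [hb, Finset.sum_comm]; exact h1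
  calc ∑ i ∈ S, ∑ j ∈ T, negMulLog (w i j)
      ≤ ∑ i ∈ S, ∑ j ∈ T, (-w i j * log (a i) + -w i j * log (b j) + a i * b j - w i j) := by
        refine Finset.sum_le_sum fun i hi => Finset.sum_le_sum fun j hj => ?_
        have hwa : a i = 0 → w i j = 0 := fun h =>
          (Finset.sum_eq_zero_iff_of_nonneg fun j _ => hw i j).1 h j hj
        have hwb : b j = 0 → w i j = 0 := fun h =>
          (Finset.sum_eq_zero_iff_of_nonneg fun i _ => hw i j).1 h i hi
        refine (negMulLog_le_cross (hw i j) (mul_nonneg (ha0 i) (hb0 j)) fun h =>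
          (mul_eq_zero.1 h).elim hwa hwb).trans (le_of_eq ?_)
        by_cases h : w i j = 0
        · simp [h]
        · rw [log_mul (mt hwa h) (mt hwb h)]
          ring
    _ = ∑ i ∈ S, negMulLog (a i) + ∑ j ∈ T, negMulLog (b j) +
          ((∑ i ∈ S, a i) * ∑ j ∈ T, b j) - ∑ i ∈ S, a i := by
        simp only [Finset.sum_sub_distrib, Finset.sum_add_distrib]
        have hA : ∑ i ∈ S, ∑ j ∈ T, -w i j * log (a i) = ∑ i ∈ S, negMulLog (a i) :=
          Finset.sum_congr rfl fun i _ => by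
            rw [← Finset.sum_mul, Finset.sum_neg_distrib, negMulLog]
        have hB : ∑ i ∈ S, ∑ j ∈ T, -w i j * log (b j) = ∑ j ∈ T, negMulLog (b j) := by
          rw [Finset.sum_comm]
          exact Finset.sum_congr rfl fun j _ => by
            rw [← Finset.sum_mul, Finset.sum_neg_distrib, negMulLog]
        rw [hA, hB, ← Finset.sum_mul_sum]
    _ = _ := by rw [ha1, hb1]; ring

end Real

/-! ### Shannon entropy of finitely valued random variables -/

namespace MeasureTheory

open Real

/-- The Shannon entropy of a random variable with values in `P`. -/
noncomputable def finiteEntropy {Ω α : Type*} [MeasurableSpace Ω] (ν : Measure Ω) (P : Finset α)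
    (X : Ω → α) : ℝ :=
  ∑ x ∈ P, negMulLog (ν.real (X ⁻¹' {x}))

theorem finiteEntropy_nonneg {Ω α : Type*} [MeasurableSpace Ω] {ν : Measure Ω}
    [IsProbabilityMeasure ν] (P : Finset α) (X : Ω → α) : 0 ≤ finiteEntropy ν P X :=
  Finset.sum_nonneg fun _ _ => negMulLog_nonneg measureReal_nonneg measureReal_le_one

variable {Ω α β : Type*} [MeasurableSpace Ω] [MeasurableSpace α] [MeasurableSpace β]
  [MeasurableSingletonClass α] [MeasurableSingletonClass β]

theorem sum_measureReal_inter_preimage_singleton {ν : Measure Ω} [IsFiniteMeasure ν] {X : Ω → α}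
    (hX : Measurable X) {P : Finset α} (hP : ∀ ω, X ω ∈ P) (E : Set Ω) :
    ∑ x ∈ P, ν.real (X ⁻¹' {x} ∩ E) = ν.real E := by
  have h := sum_measureReal_preimage_singleton (μ := ν.restrict E) (f := X) P
    fun y _ => hX (measurableSet_singleton y)
  rw [show X ⁻¹' (P : Set α) = Set.univ from Set.eq_univ_of_forall hP] at h
  rw [measureReal_restrict_apply MeasurableSet.univ, Set.univ_inter] at h
  rw [← h]
  exact Finset.sum_congr rfl fun x _ =>
    (measureReal_restrict_apply (hX (measurableSet_singleton x))).symm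

variable {ν : Measure Ω} [IsProbabilityMeasure ν]

/-- The entropy of a random variable `Y` which takes at most `D` values given that of `X`. -/
theorem finiteEntropy_le_add_log [DecidableEq β] {X : Ω → α} {Y : Ω → β} (hX : Measurable X)
    (hY : Measurable Y) {P : Finset α} (hP : ∀ ω, X ω ∈ P) (T : α → Finset β)
    (hT : ∀ ω, Y ω ∈ T (X ω)) {D : ℕ} (hD : ∀ x, (T x).card ≤ D) :
    finiteEntropy ν (P.biUnion T) Y ≤ finiteEntropy ν P X + log D := by
  have hYT : ∀ ω, Y ω ∈ P.biUnion T := fun ω => Finset.mem_biUnion.2 ⟨X ω, hP ω, hT ω⟩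
  calc finiteEntropy ν (P.biUnion T) Y
      = ∑ y ∈ P.biUnion T, negMulLog (∑ x ∈ P, ν.real (X ⁻¹' {x} ∩ Y ⁻¹' {y})) := by
        simp only [sum_measureReal_inter_preimage_singleton hX hP, finiteEntropy]
    _ ≤ ∑ y ∈ P.biUnion T, ∑ x ∈ P, negMulLog (ν.real (X ⁻¹' {x} ∩ Y ⁻¹' {y})) :=
        Finset.sum_le_sum fun y _ => negMulLog_sum_le _ fun x _ => measureReal_nonneg
    _ = ∑ x ∈ P, ∑ y ∈ T x, negMulLog (ν.real (X ⁻¹' {x} ∩ Y ⁻¹' {y})) := by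
        rw [Finset.sum_comm]
        refine Finset.sum_congr rfl fun x hx => (Finset.sum_subset
          (Finset.subset_biUnion_of_mem T hx) fun y _ hy => ?_).symm
        rw [show X ⁻¹' {x} ∩ Y ⁻¹' {y} = ∅ from
          Set.eq_empty_of_forall_notMem fun ω hω => hy (by
            obtain ⟨rfl, rfl⟩ := hω
            exact hT ω)]
        simp
    _ ≤ ∑ x ∈ P, (negMulLog (ν.real (X ⁻¹' {x})) + ν.real (X ⁻¹' {x}) * log D) := by
        refine Finset.sum_le_sum fun x hx => ?_
        have hs : ∑ y ∈ T x, ν.real (X ⁻¹' {x} ∩ Y ⁻¹' {y}) = ν.real (X ⁻¹' {x}) := by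
          rw [← sum_measureReal_inter_preimage_singleton hY hYT (X ⁻¹' {x})]
          simp only [Set.inter_comm (X ⁻¹' {x})]
          refine Finset.sum_subset (Finset.subset_biUnion_of_mem T hx) fun y _ hy => ?_
          rw [show Y ⁻¹' {y} ∩ X ⁻¹' {x} = ∅ from
            Set.eq_empty_of_forall_notMem fun ω hω => hy (by
              obtain ⟨rfl, rfl⟩ := hω
              exact hT ω)]
          simp
        refine (sum_negMulLog_le_add_log_card (T x) fun y _ => measureReal_nonneg).trans ?_
        rw [hs]
        exact add_le_add_right
          (mul_le_mul_of_nonneg_left (log_natCast_le_log_natCast (hD x)) measureReal_nonneg) _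
    _ = finiteEntropy ν P X + log D := by
        rw [Finset.sum_add_distrib, ← Finset.sum_mul]
        have := sum_measureReal_inter_preimage_singleton (ν := ν) hX hP Set.univ
        simp only [Set.inter_univ, probReal_univ] at this
        rw [this, one_mul, finiteEntropy]

/-- The entropy of a function of two random variables is at most the sum of their entropies. -/
theorem finiteEntropy_comp_le_add {γ : Type*} [MeasurableSpace γ] [DecidableEq γ]
    {X : Ω → α} {Y : Ω → β} (hX : Measurable X) (hY : Measurable Y) {P : Finset α} {Q : Finset β}
    {R : Finset γ} (hP : ∀ ω, X ω ∈ P) (hQ : ∀ ω, Y ω ∈ Q) (g : α × β → γ)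
    (hg : ∀ p ∈ P ×ˢ Q, g p ∈ R) :
    finiteEntropy ν R (fun ω => g (X ω, Y ω)) ≤ finiteEntropy ν P X + finiteEntropy ν Q Y := by
  have hXY : Measurable fun ω => (X ω, Y ω) := hX.prodMk hY
  have hpair : ∀ x y, (fun ω => (X ω, Y ω)) ⁻¹' {(x, y)} = X ⁻¹' {x} ∩ Y ⁻¹' {y} := by
    intro x y
    ext ω
    simp
  have hYX : ∀ x, ∑ y ∈ Q, ν.real (X ⁻¹' {x} ∩ Y ⁻¹' {y}) = ν.real (X ⁻¹' {x}) := by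
    intro x
    simp only [Set.inter_comm (X ⁻¹' {x})]
    exact sum_measureReal_inter_preimage_singleton hY hQ _
  calc finiteEntropy ν R (fun ω => g (X ω, Y ω))
      ≤ ∑ z ∈ R, ∑ p ∈ P ×ˢ Q with g p = z,
          negMulLog (ν.real ((fun ω => (X ω, Y ω)) ⁻¹' {p})) := by
        refine Finset.sum_le_sum fun z _ => ?_
        refine le_trans (le_of_eq ?_) (negMulLog_sum_le _ fun p _ => measureReal_nonneg)
        rw [sum_measureReal_preimage_singleton _ fun p _ => hXY (measurableSet_singleton p)]
        congr 2
        ext ω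
        simp [hP, hQ]
    _ = ∑ x ∈ P, ∑ y ∈ Q, negMulLog (ν.real (X ⁻¹' {x} ∩ Y ⁻¹' {y})) := by
        rw [Finset.sum_fiberwise_of_maps_to hg, Finset.sum_product]
        simp only [hpair]
    _ ≤ ∑ x ∈ P, negMulLog (∑ y ∈ Q, ν.real (X ⁻¹' {x} ∩ Y ⁻¹' {y})) +
          ∑ y ∈ Q, negMulLog (∑ x ∈ P, ν.real (X ⁻¹' {x} ∩ Y ⁻¹' {y})) := by
        refine sum_product_negMulLog_le P Q (fun _ _ => measureReal_nonneg) ?_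
        simp only [hYX]
        have := sum_measureReal_inter_preimage_singleton (ν := ν) hX hP Set.univ
        simpa using this
    _ = finiteEntropy ν P X + finiteEntropy ν Q Y := by
        simp only [hYX, sum_measureReal_inter_preimage_singleton hX hP, finiteEntropy]

end MeasureTheory

/-! ### Entropy of the points versus entropy dimension -/

section

open Real

theorem mem_dyadicInterval_iff {n : ℕ} {k : ℤ} {x : ℝ} :
    x ∈ dyadicInterval n k ↔ ⌊2 ^ n * x⌋ = k := by
  have h : (0 : ℝ) < 2 ^ n := by positivity
  rw [dyadicInterval, Set.mem_Ico, Int.floor_eq_iff, div_le_iff₀' h, lt_div_iff₀' h]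

theorem scaleEntropy_map_eq {Ω : Type*} [MeasurableSpace Ω] {ν : Measure Ω}
    [IsProbabilityMeasure ν] {X : Ω → ℝ} (hX : Measurable X) (n : ℕ) {T : Finset ℤ}
    (hT : ∀ ω, ⌊2 ^ n * X ω⌋ ∈ T) :
    scaleEntropy (ν.map X) n =
      ENNReal.ofReal (finiteEntropy ν T (fun ω => ⌊2 ^ n * X ω⌋) / log 2) := by
  have h1 : ∀ k, (ν.map X).real (dyadicInterval n k) =
      ν.real ((fun ω => ⌊2 ^ n * X ω⌋) ⁻¹' {k}) := by
    intro k
    rw [map_measureReal_apply hX (show MeasurableSet (dyadicInterval n k) from measurableSet_Ico)]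
    congr 1
    ext ω
    exact mem_dyadicInterval_iff
  rw [scaleEntropy, tsum_eq_sum (s := T), finiteEntropy, Finset.sum_div,
    ENNReal.ofReal_sum_of_nonneg]
  · refine Finset.sum_congr rfl fun k _ => ?_
    rw [h1, negMulLog, logb]
    congr 1
    ring
  · intro k _
    exact div_nonneg (negMulLog_nonneg measureReal_nonneg measureReal_le_one)
      (log_nonneg one_le_two)
  · intro k hk
    rw [h1, show (fun ω => ⌊2 ^ n * X ω⌋) ⁻¹' {k} = ∅ from
      Set.eq_empty_of_forall_notMem fun ω hω => hk (by
        obtain rfl := hω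
        exact hT ω)]
    simp

theorem measurable_leftShift {Γ : Type*} [MeasurableSpace Γ] :
    Measurable (leftShift : (ℕ → Γ) → ℕ → Γ) :=
  measurable_pi_lambda _ fun n => measurable_pi_apply (n + 1)

namespace HomogeneousAffineIFS

variable {Γ : Type*} [MeasurableSpace Γ]

theorem measurable_partialSum [DiscreteMeasurableSpace Γ] (F : HomogeneousAffineIFS Γ) (n : ℕ) :
    Measurable (F.partialSum n) :=
  Finset.measurable_fun_sum _ fun j _ => Measurable.mul_const
    ((Measurable.of_discrete (f := F.translation)).comp (measurable_pi_apply j)) _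

variable [Finite Γ]

/-- The entropy of the position `f_{i_1} ⋯ f_{i_n}(0)` of a random word. -/
noncomputable def pointEntropy (F : HomogeneousAffineIFS Γ) (ν : Measure (ℕ → Γ)) (n : ℕ) : ℝ :=
  finiteEntropy ν (F.points n) (F.partialSum n)

variable {ν : Measure (ℕ → Γ)} [IsProbabilityMeasure ν]

theorem pointEntropy_nonneg (F : HomogeneousAffineIFS Γ) (n : ℕ) : 0 ≤ F.pointEntropy ν n :=
  finiteEntropy_nonneg _ _

theorem pointEntropy_zero (F : HomogeneousAffineIFS Γ) : F.pointEntropy ν 0 = 0 := by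
  refine Finset.sum_eq_zero fun z hz => ?_
  obtain ⟨i, rfl⟩ := mem_points.1 hz
  rw [show F.partialSum 0 ⁻¹' {F.partialSum 0 i} = Set.univ from
    Set.eq_univ_of_forall fun j => by simp [partialSum]]
  simp

variable [DiscreteMeasurableSpace Γ]

/-- The level-`(m + n)` point is a function of the level-`m` point and the level-`n` point of the
shifted word, whose law is unchanged by invariance. -/
theorem pointEntropy_add_le (F : HomogeneousAffineIFS Γ) (hν : MeasurePreserving leftShift ν ν)
    (m n : ℕ) : F.pointEntropy ν (m + n) ≤ F.pointEntropy ν m + F.pointEntropy ν n := by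
  have hshift : finiteEntropy ν (F.points n) (fun i => F.partialSum n (leftShift^[m] i)) =
      F.pointEntropy ν n := by
    refine Finset.sum_congr rfl fun z _ => ?_
    rw [measureReal_def, measureReal_def, ← (hν.iterate m).measure_preimage
      (F.measurable_partialSum n (measurableSet_singleton z)).nullMeasurableSet]
    rfl
  have h := finiteEntropy_comp_le_add (ν := ν) (F.measurable_partialSum m)
    ((F.measurable_partialSum n).comp (measurable_leftShift.iterate m))
    (F.partialSum_mem_points m) (fun i => F.partialSum_mem_points n (leftShift^[m] i))
    (fun p => p.1 + F.ratio ^ m * p.2) (R := F.points (m + n))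
    fun p hp => add_mem_points (Finset.mem_product.1 hp).1 (Finset.mem_product.1 hp).2
  simp only [Function.comp_apply, ← partialSum_add] at h
  rw [← hshift]
  exact h

theorem pointEntropy_mul_le (F : HomogeneousAffineIFS Γ) (hν : MeasurePreserving leftShift ν ν)
    (k n : ℕ) : F.pointEntropy ν (k * n) ≤ k * F.pointEntropy ν n := by
  induction k with
  | zero => rw [zero_mul, pointEntropy_zero, Nat.cast_zero, zero_mul]
  | succ k ih =>
    rw [Nat.succ_mul, Nat.cast_succ, add_mul, one_mul]
    exact (F.pointEntropy_add_le hν _ _).trans (by linarith)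

/-- The level-`n` point is within `B * r ^ n ≤ B * 2 ^ (-k)` of `π(i)`, so it leaves `2 * ⌈B⌉₊ + 2`
candidates for the dyadic cell. -/
theorem exists_scaleEntropy_le (F : HomogeneousAffineIFS Γ) (ν : Measure (ℕ → Γ))
    [IsProbabilityMeasure ν] :
    ∃ C : ℝ, 0 ≤ C ∧ ∀ n k : ℕ, F.ratio ^ n * 2 ^ k ≤ 1 →
      scaleEntropy (ν.map F.coding) k ≤ ENNReal.ofReal ((F.pointEntropy ν n + C) / log 2) := by
  obtain ⟨B, hB0, hB⟩ := F.exists_partialSum_bound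
  refine ⟨log ((2 * ⌈B⌉₊ + 2 : ℕ) : ℝ), log_natCast_nonneg _, fun n k hnk => ?_⟩
  set T : ℝ → Finset ℤ := fun z => Finset.Icc (⌊2 ^ k * z⌋ - ⌈B⌉₊) (⌊2 ^ k * z⌋ + ⌈B⌉₊ + 1)
  have hT : ∀ i, ⌊2 ^ k * F.coding i⌋ ∈ T (F.partialSum n i) := by
    intro i
    have h1 := mul_le_mul_of_nonneg_left (F.abs_coding_sub_partialSum_le hB n i)
      (show (0 : ℝ) ≤ 2 ^ k by positivity)
    have h2 : 2 ^ k * (B * F.ratio ^ n) ≤ ⌈B⌉₊ :=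
      le_trans (by nlinarith) (Nat.le_ceil B)
    rw [← abs_of_pos (show (0 : ℝ) < 2 ^ k by positivity), ← abs_mul,
      abs_of_pos (show (0 : ℝ) < 2 ^ k by positivity), mul_sub] at h1
    obtain ⟨h3, h4⟩ := abs_le.1 (h1.trans h2)
    have h5 := Int.floor_le (2 ^ k * F.partialSum n i)
    have h6 := Int.lt_floor_add_one (2 ^ k * F.partialSum n i)
    refine Finset.mem_Icc.2 ⟨Int.le_floor.2 ?_, Int.lt_add_one_iff.1 (Int.floor_lt.2 ?_)⟩
    · push_cast
      linarith
    · push_cast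
      linarith
  have hm : Measurable fun i => ⌊2 ^ k * F.coding i⌋ :=
    Int.measurable_floor.comp (F.measurable_coding.const_mul _)
  rw [scaleEntropy_map_eq F.measurable_coding k (T := (F.points n).biUnion T) fun i =>
    Finset.mem_biUnion.2 ⟨_, F.partialSum_mem_points n i, hT i⟩]
  refine ENNReal.ofReal_le_ofReal (div_le_div_of_nonneg_right ?_ (log_nonneg one_le_two))
  refine finiteEntropy_le_add_log (F.measurable_partialSum n) hm (F.partialSum_mem_points n) T hT
    fun z => ?_
  simp only [T, Int.card_Icc]
  omega

/-- The entropy of the positions grows at least as fast as the entropy dimension predicts. -/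
theorem le_pointEntropy_of_le_entropyDim (F : HomogeneousAffineIFS Γ)
    (hν : MeasurePreserving leftShift ν ν) {s : ℝ≥0} (hs : s ≤ entropyDim (ν.map F.coding))
    (n : ℕ) : n * (s * -log F.ratio) ≤ F.pointEntropy ν n := by
  obtain ⟨C, hC0, hC⟩ := F.exists_scaleEntropy_le ν
  have hL : 0 < -log F.ratio := neg_pos.2 (log_neg F.ratio_pos F.ratio_lt_one)
  have hlog2 : 0 < log 2 := log_pos one_lt_two
  have hh := F.pointEntropy_nonneg (ν := ν) n
  rcases n.eq_zero_or_pos with rfl | hn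
  · simpa using hh
  have hnL : 0 < n * -log F.ratio := mul_pos (Nat.cast_pos.2 hn) hL
  suffices (s : ℝ) ≤ F.pointEntropy ν n / (n * -log F.ratio) by
    rw [le_div_iff₀ hnL] at this
    linarith
  refine le_of_forall_lt_imp_le_of_dense fun c hc => ?_
  rcases le_or_gt c 0 with hc0 | hc0
  · exact hc0.trans (by positivity)
  rw [le_div_iff₀ hnL]
  have hcs : ENNReal.ofReal c < entropyDim (ν.map F.coding) := by
    refine lt_of_lt_of_le ?_ hs
    rw [← ENNReal.ofReal_coe_nnreal]
    exact (ENNReal.ofReal_lt_ofReal_iff (hc0.trans hc)).2 hc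
  have hev := eventually_lt_of_lt_liminf hcs
  -- The largest `k` with `r ^ (j * n) * 2 ^ k ≤ 1`.
  set k : ℕ → ℕ := fun j => ⌊(j : ℝ) * (n * -log F.ratio / log 2)⌋₊ with hk
  have hktop : Tendsto k atTop atTop := tendsto_nat_floor_atTop.comp
    (tendsto_natCast_atTop_atTop.atTop_mul_const (div_pos hnL hlog2))
  -- The right side does not depend on `j`, so letting `j → ∞` removes all additive errors.
  have hmain : ∀ᶠ j : ℕ in atTop,
      j * (c * (n * -log F.ratio) - F.pointEntropy ν n) ≤ C + c * log 2 := by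
    filter_upwards [hktop.eventually hev, hktop.eventually (eventually_gt_atTop 0)] with j hj hk0
    have hk1 : (k j : ℝ) * log 2 ≤ j * (n * -log F.ratio) := by
      rw [← le_div_iff₀ hlog2, mul_div_assoc]
      exact Nat.floor_le (by positivity)
    have hk2 : j * (n * -log F.ratio) < (k j + 1) * log 2 := by
      rw [← div_lt_iff₀ hlog2, mul_div_assoc]
      exact Nat.lt_floor_add_one _
    have hr : F.ratio ^ (j * n) * 2 ^ k j ≤ 1 := by
      have h0 : 0 < F.ratio ^ (j * n) := pow_pos F.ratio_pos _
      rw [← log_nonpos_iff (by positivity), log_mul h0.ne' (by positivity), log_pow, log_pow]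
      push_cast
      linarith
    have h1 := hj.trans_le (ENNReal.div_le_div_right (hC (j * n) (k j) hr) _)
    rw [ENNReal.lt_div_iff_mul_lt (Or.inl (by exact_mod_cast hk0.ne'))
      (Or.inl (ENNReal.natCast_ne_top _)), ← ENNReal.ofReal_natCast,
      ← ENNReal.ofReal_mul hc0.le, ENNReal.ofReal_lt_ofReal_iff', lt_div_iff₀ hlog2] at h1
    have h2 := F.pointEntropy_mul_le hν j n
    have h3 : c * (j * (n * -log F.ratio)) ≤ c * ((k j + 1) * log 2) :=
      mul_le_mul_of_nonneg_left hk2.le hc0.le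
    linarith [h1.1]
  by_contra! hlt
  have htop : Tendsto (fun j : ℕ => (j : ℝ) * (c * (n * -log F.ratio) - F.pointEntropy ν n))
      atTop atTop := tendsto_natCast_atTop_atTop.atTop_mul_const (sub_pos.2 hlt)
  obtain ⟨j, h1, h2⟩ := (hmain.and (htop.eventually_gt_atTop (C + c * log 2))).exists
  exact h1.not_gt h2

/-! ### Null compact sets and absolute continuity -/

theorem WeakSeparation.measure_preimage_coding_eq_zero [Nonempty Γ] {F : HomogeneousAffineIFS Γ}
    (hF : F.WeakSeparation) {K : Set ℝ} (hK : F.IsAttractor K)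
    (hν : MeasurePreserving leftShift ν ν) {s : ℝ≥0} (hs0 : 0 < s) (hsK : dimH K ≤ s)
    (hsμ : s ≤ entropyDim (ν.map F.coding)) {A : Set ℝ} (hA : IsCompact A)
    (hA0 : μH[(s : ℝ)] A = 0) : ν (F.coding ⁻¹' A) = 0 := by
  classical
  obtain ⟨M, hM0, hM⟩ := hF.exists_card_points_mul_pow_le hK hsK
  obtain ⟨M', hM0', hM'⟩ := hF.exists_card_pointsMeeting_le
  have hMM : (0 : ℝ) < M' * M := mul_pos (Nat.cast_pos.2 hM0') hM0
  have hM1 : 1 ≤ M := by simpa [card_points_zero] using hM 0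
  by_contra hne
  set p := ν.real (F.coding ⁻¹' A)
  have hp : 0 < p := ENNReal.toReal_pos hne (measure_ne_top _ _)
  set ρ := F.ratio ^ (s : ℝ) with hρdef
  have hρ : 0 < ρ := Real.rpow_pos_of_pos F.ratio_pos _
  obtain ⟨J, x, m, hJ, hsum⟩ := hA.exists_finite_cover_of_hausdorffMeasure_eq_zero hA0
    F.ratio_pos F.ratio_lt_one (NNReal.coe_pos.2 hs0)
    -- Chosen so that mass at least `p` on `S` costs `log M + 2` in entropy, beating the possible
    -- gain `log M + 1`.
    (ε := exp (-(log M + 2) / p) / (M' * M)) (by positivity)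
  set n := J.sup m
  have hmn : ∀ j ∈ J, m j ≤ n := fun j hj => Finset.le_sup hj
  set P := F.points n
  set S := F.pointsMeeting n A
  have hSP : S ⊆ P := Finset.filter_subset _ _
  have hScard : (S.card : ℝ) * ρ ^ n ≤ exp (-(log M + 2) / p) := by
    have h1 : (S.card : ℝ) ≤ M' * ∑ j ∈ J, ((F.points (n - m j)).card : ℝ) := by
      exact_mod_cast hM' A J x m n hJ hmn
    calc (S.card : ℝ) * ρ ^ n
        ≤ (M' * ∑ j ∈ J, ((F.points (n - m j)).card : ℝ)) * ρ ^ n :=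
          mul_le_mul_of_nonneg_right h1 (pow_pos hρ n).le
      _ = M' * ∑ j ∈ J, ((F.points (n - m j)).card * ρ ^ (n - m j)) * ρ ^ m j := by
          rw [mul_assoc, Finset.sum_mul]
          congr 1
          refine Finset.sum_congr rfl fun j hj => ?_
          rw [mul_assoc, ← pow_add, Nat.sub_add_cancel (hmn j hj)]
      _ ≤ M' * ∑ j ∈ J, M * ρ ^ m j := by
          gcongr with j hj
          exact hM _
      _ = M' * M * ∑ j ∈ J, ρ ^ m j := by rw [← Finset.mul_sum, mul_assoc]
      _ ≤ M' * M * (exp (-(log M + 2) / p) / (M' * M)) :=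
          mul_le_mul_of_nonneg_left hsum hMM.le
      _ = _ := mul_div_cancel₀ _ hMM.ne'
  set q : ℝ → ℝ := fun z => ν.real (F.partialSum n ⁻¹' {z})
  have hq0 : ∀ z, 0 ≤ q z := fun z => measureReal_nonneg
  have hmeas : ∀ z, MeasurableSet (F.partialSum n ⁻¹' {z}) := fun z =>
    F.measurable_partialSum n (measurableSet_singleton z)
  have hqP : ∑ z ∈ P \ S, q z + ∑ z ∈ S, q z = 1 := by
    rw [Finset.sum_sdiff hSP]
    have := sum_measureReal_inter_preimage_singleton (ν := ν) (F.measurable_partialSum n)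
      (F.partialSum_mem_points n) Set.univ
    simpa using this
  set a := ∑ z ∈ S, q z
  set b := ∑ z ∈ P \ S, q z
  have hb0 : 0 ≤ b := Finset.sum_nonneg fun z _ => hq0 z
  have hpa : p ≤ a := by
    have h1 : a = ν.real (F.partialSum n ⁻¹' (S : Set ℝ)) :=
      sum_measureReal_preimage_singleton S fun z _ => hmeas z
    rw [h1]
    exact measureReal_mono fun i hi =>
      Finset.mem_coe.2 (Finset.mem_filter.2 ⟨F.partialSum_mem_points n i, i, rfl, hi⟩)
  have ha0 : 0 < a := hp.trans_le hpa
  have hSpos : 0 < S.card := by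
    rw [Finset.card_pos, Finset.nonempty_iff_ne_empty]
    intro h
    simp only [a, h, Finset.sum_empty, lt_self_iff_false] at ha0
  have hlogρ : log (ρ ^ n) = -(n * (s * -log F.ratio)) := by
    rw [log_pow, hρdef, log_rpow F.ratio_pos]
    ring
  have hlogS : log S.card ≤ -(log M + 2) / p + n * (s * -log F.ratio) := by
    have h1 := log_le_log (mul_pos (Nat.cast_pos.2 hSpos) (pow_pos hρ n)) hScard
    rw [log_exp, log_mul (Nat.cast_pos.2 hSpos).ne' (pow_pos hρ n).ne', hlogρ] at h1
    linarith
  have hP0 : 0 < P.card := hSpos.trans_le (Finset.card_le_card hSP)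
  have hlogP : log P.card ≤ log M + n * (s * -log F.ratio) := by
    have h1 := log_le_log (mul_pos (Nat.cast_pos.2 hP0) (pow_pos hρ n)) (hM n)
    rw [log_mul (Nat.cast_pos.2 hP0).ne' (pow_pos hρ n).ne', hlogρ] at h1
    linarith
  have hlogPS : log (P \ S).card ≤ log P.card :=
    log_natCast_le_log_natCast (Finset.card_le_card Finset.sdiff_subset)
  have hupper : F.pointEntropy ν n ≤
      (negMulLog b + b * log (P \ S).card) + (negMulLog a + a * log S.card) := by
    have h1 := sum_negMulLog_le_add_log_card (P \ S) fun z _ => hq0 z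
    have h2 := sum_negMulLog_le_add_log_card S fun z _ => hq0 z
    have h3 : F.pointEntropy ν n = ∑ z ∈ P \ S, negMulLog (q z) + ∑ z ∈ S, negMulLog (q z) :=
      (Finset.sum_sdiff hSP).symm
    rw [h3]
    exact add_le_add h1 h2
  have hlower := F.le_pointEntropy_of_le_entropyDim hν hsμ n
  have h1 := negMulLog_le_one_sub_self ha0.le
  have h2 := negMulLog_le_one_sub_self hb0
  have h3 := mul_le_mul_of_nonneg_left hlogS ha0.le
  have h4 := mul_le_mul_of_nonneg_left (hlogPS.trans hlogP) hb0
  have hlogM : 0 ≤ log M := log_nonneg hM1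
  have h5 : a * (-(log M + 2) / p) ≤ -(log M + 2) := by
    rw [mul_div_assoc', div_le_iff₀ hp]
    nlinarith
  have h6 : b * log M ≤ log M := mul_le_of_le_one_left hlogM (by linarith)
  have h7 : a * (n * (s * -log F.ratio)) + b * (n * (s * -log F.ratio)) =
      n * (s * -log F.ratio) := by
    rw [← add_mul, add_comm a b, hqP, one_mul]
  rw [mul_add] at h3 h4
  -- The two `negMulLog` terms add up to at most `2 - (a + b) = 1`, so the upper bound falls at
  -- least `1` short of `hlower`.
  linarith

end HomogeneousAffineIFS

end

theorem mainTheorem10 {Γ : Type*} [Fintype Γ] [Nontrivial Γ]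
    [MeasurableSpace Γ] [DiscreteMeasurableSpace Γ]
    (F : HomogeneousAffineIFS Γ) (hF : F.WeakSeparation)
    (K : Set ℝ) (hK : F.IsAttractor K)
    (ν : Measure (ℕ → Γ)) [IsProbabilityMeasure ν] (hν : MeasurePreserving leftShift ν ν)
    (μ : Measure ℝ) (hμ : μ = ν.map F.coding)
    (s : ℝ≥0) (hdimμ : entropyDim μ = s) (hdimK : dimH K = s) :
    μ ≪ μH[(s : ℝ)] := by
  subst hμ
  have : IsProbabilityMeasure (ν.map F.coding) :=
    Measure.isProbabilityMeasure_map F.measurable_coding.aemeasurable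
  refine Measure.AbsolutelyContinuous.mk fun A hA hA0 => ?_
  -- The covering argument needs `s > 0`; for `s = 0` only the empty set is null.
  rcases eq_or_ne s 0 with rfl | hs
  · rcases A.eq_empty_or_nonempty with rfl | hne
    · exact measure_empty
    · have h1 := Measure.one_le_hausdorffMeasure_zero_of_nonempty hne
      rw [NNReal.coe_zero] at hA0
      simp [hA0] at h1
  · by_contra hne
    -- Inner regularity supplies a compact set, as finite subcovers require.
    obtain ⟨A', hAA', hA', hpos⟩ := hA.exists_lt_isCompact (pos_iff_ne_zero.2 hne)
    rw [Measure.map_apply F.measurable_coding hA'.measurableSet,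
      hF.measure_preimage_coding_eq_zero hK hν (pos_iff_ne_zero.2 hs) hdimK.le hdimμ.ge hA'
        (measure_mono_null hAA' hA0)] at hpos
    exact lt_irrefl _ hpos
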